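/- Let $T>0$, $\alpha>0$, $N\ge 1$, let $\Omega\subset\mathbb{R}^n$ be open, let $\omega_1,\dots,\omega_N\subset\Omega$ be measurable sets of positive finite measure, let $\omega_{\mathrm{obs}}\subset\Omega$ be measurable, and let $y_0\in L^2(\Omega)$, $y^d\in L^2(0,T;L^2(\omega_{\mathrm{obs}}))$. Let $Ay=\operatorname{div}(a\nabla y)-b\cdot\nabla y-cy$ with coefficients $a\in L^\infty(\Omega;\mathbb{R}^{n\times n})$, $b\in L^\infty(\Omega;\mathbb{R}^n)$, $c\in L^\infty(\Omega)$ be elliptic, i.e. $a(x)\xi\cdot\xi>0$ for all $\xi\neq0$ and almost every $x\in\Omega$, and let the boundary conditions be given by a closed subspace $V$ with $H^1_0(\Omega)\subset V\subset H^1(\Omega)$ (e.g. $V=H^1_0(\Omega)$ for homogeneous Dirichlet and $V=H^1(\Omega)$ for homogeneous Neumann conditions). For $u\in L^2(0,T;\mathbb{R}^N)$ put $(Bu)(t,x)=\sum_{i=1}^N\chi_{\omega_i}(x)u_i(t)$. Assume that for every $u\in L^2(0,T;\mathbb{R}^N)$ the state equation $$\partial_t y-Ay=Bu \ \text{ on }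 (0,T)\times\Omega,\qquad y(0)=y_0,$$ has a unique weak solution $y=:Su\in L^2(0,T;V)$, that is, for all $v\in V$ and $\eta\in C_c^\infty((-\infty,T))$, $$-\int_0^T\eta'(y,v)_{L^2(\Omega)}\,dt+\int_0^T\eta\int_\Omega\bigl(a\nabla y\cdot\nabla v+(b\cdot\nabla y)v+cyv\bigr)\,dx\,dt=\int_0^T\eta\,(Bu,v)_{L^2(\Omega)}\,dt+\eta(0)(y_0,v)_{L^2(\Omega)}.$$ Set $$\mathcal F(u)=\tfrac12\|Su-y^d\|^2_{L^2(0,T;L^2(\omega_{\mathrm{obs}}))},\qquad \mathcal G(u)=\frac\alpha2\int_0^T\Bigl(\sum_{j=1}^N|u_j(t)|\Bigr)^2dt ,$$ and let $\bar u$ be a minimizer of $\mathcal F+\mathcal G$ over $L^2(0,T;\mathbb{R}^N)$. Then $\mathcal F$ is Fréchet differentiable at $\bar u$, and with $\bar p:=-\mathcal F'(\bar u)\in L^2(0,T;\mathbb{R}^N)$ (the derivative being identified with the $L^2$-gradient) and $\mathcal A(t):=\{j:|\bar p_j(t)|=\max_i|\bar p_i(t)|\}$ the following hold. 1. For almost every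 $t\in(0,T)$ there are $s_1,\dots,s_N\ge0$ with $\sum_{i\in\mathcal A(t)}s_i=1$ such that for every $1\le j\le N$: - if $|\bar p_j(t)|=\max_i|\bar p_i(t)|$ and $|\bar p_j(t)|>|\bar p_i(t)|$ for all $i\ne j$, then $\bar u_j(t)=\frac1\alpha\bar p_j(t)$; - if $|\bar p_j(t)|<\max_i|\bar p_i(t)|$, then $\bar u_j(t)=0$; - if $|\bar p_j(t)|=\max_i|\bar p_i(t)|$ and $|\bar p_j(t)|=|\bar p_i(t)|$ for some $i\neq j$, then $\bar u_j(t)=\frac{s_j}\alpha\bar p_j(t)$. 2. For almost every $t\in(0,T)$ outside the singular arc $\mathcal S:=\{t\in(0,T):|\mathcal A(t)|>1\}$, one has $\bar u_{j_1}(t)\,\bar u_{j_2}(t)=0$ for all $j_1\neq j_2$. -/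

import Mathlib

open MeasureTheory Set
open scoped ContDiff

noncomputable section

namespace SwitchingControl

/-- Lebesgue measure on the time interval `(0,T)`. -/
abbrev timeMeasure (T : ℝ) : Measure ℝ := volume.restrict (Ioo 0 T)

/-- The control space `L²(0,T;ℝ^N)`, with the Euclidean inner product on `ℝ^N`. -/
abbrev Control (T : ℝ) (N : ℕ) : Type := Lp (EuclideanSpace ℝ (Fin N)) 2 (timeMeasure T)

section Sobolev

variable {n : ℕ}

/-- `L²(Ω)`. -/
abbrev L2 (Ω : Set (EuclideanSpace ℝ (Fin n))) : Type := Lp ℝ 2 (volume.restrict Ω)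

/-- `L²(Ω;ℝⁿ)`. -/
abbrev L2vec (Ω : Set (EuclideanSpace ℝ (Fin n))) : Type :=
  Lp (EuclideanSpace ℝ (Fin n)) 2 (volume.restrict Ω)

/-- The Hilbert space `L²(Ω) × L²(Ω;ℝⁿ)`. An element of `H¹(Ω)` is represented by the pair of the
function and its weak gradient, so that the norm induced here is the `H¹`-norm. -/
abbrev L2Pair (Ω : Set (EuclideanSpace ℝ (Fin n))) : Type := WithLp 2 (L2 Ω × L2vec Ω)

/-- `φ ∈ C_c^∞(Ω)`. -/
def IsTestFunction (Ω : Set (EuclideanSpace ℝ (Fin n))) (φ : EuclideanSpace ℝ (Fin n) → ℝ) :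
    Prop :=
  ContDiff ℝ ∞ φ ∧ HasCompactSupport φ ∧ tsupport φ ⊆ Ω

/-- `(f, g)` represents an element of `H¹(Ω)`: `g` is the weak gradient of `f` in `Ω`. -/
def IsH1 (Ω : Set (EuclideanSpace ℝ (Fin n))) (w : L2Pair Ω) : Prop :=
  ∀ φ : EuclideanSpace ℝ (Fin n) → ℝ, IsTestFunction Ω φ →
    ∫ x in Ω, w.fst x • gradient φ x = -∫ x in Ω, φ x • w.snd x

/-- `H¹₀(Ω)`: the closure in the `H¹`-norm of the pairs `(φ, ∇φ)`, `φ ∈ C_c^∞(Ω)`. -/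
def H10 (Ω : Set (EuclideanSpace ℝ (Fin n))) : Submodule ℝ (L2Pair Ω) :=
  (Submodule.span ℝ {w : L2Pair Ω | ∃ φ : EuclideanSpace ℝ (Fin n) → ℝ, IsTestFunction Ω φ ∧
    w.fst =ᵐ[volume.restrict Ω] φ ∧ w.snd =ᵐ[volume.restrict Ω] gradient φ}).topologicalClosure

end Sobolev

/-- The data of the optimal control problem for the diffusion equation `∂ₜy - Ay = Bu` on
`(0,T) × Ω`, `y(0) = y₀`, with `N` scalar controls, where
`Ay = div(a∇y) - b·∇y - cy` and `(Bu)(t,x) = ∑ᵢ χ_{ωᵢ}(x) uᵢ(t)`. -/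
structure Problem (n N : ℕ) where
  /-- final time -/
  T : ℝ
  T_pos : 0 < T
  /-- spatial domain -/
  Ω : Set (EuclideanSpace ℝ (Fin n))
  isOpen_Ω : IsOpen Ω
  /-- the space `V` with `H¹₀(Ω) ⊆ V ⊆ H¹(Ω)` that carries the homogeneous boundary conditions:
  `V = H¹₀(Ω)` for Dirichlet conditions, `V = H¹(Ω)` for Neumann conditions -/
  V : Submodule ℝ (L2Pair Ω)
  isClosed_V : IsClosed (V : Set (L2Pair Ω))
  H10_le_V : H10 Ω ≤ V
  V_le_H1 : ∀ w ∈ V, IsH1 Ω w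
  /-- diffusion coefficient -/
  a : EuclideanSpace ℝ (Fin n) → EuclideanSpace ℝ (Fin n) →L[ℝ] EuclideanSpace ℝ (Fin n)
  /-- convection coefficient -/
  b : EuclideanSpace ℝ (Fin n) → EuclideanSpace ℝ (Fin n)
  /-- reaction coefficient -/
  c : EuclideanSpace ℝ (Fin n) → ℝ
  a_memLp : MemLp a ⊤ (volume.restrict Ω)
  b_memLp : MemLp b ⊤ (volume.restrict Ω)
  c_memLp : MemLp c ⊤ (volume.restrict Ω)
  elliptic : ∀ᵐ x ∂(volume.restrict Ω), ∀ ξ : EuclideanSpace ℝ (Fin n), ξ ≠ 0 →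
    0 < inner ℝ (a x ξ) ξ
  /-- control domains -/
  dom : Fin N → Set (EuclideanSpace ℝ (Fin n))
  measurableSet_dom : ∀ i, MeasurableSet (dom i)
  dom_subset : ∀ i, dom i ⊆ Ω
  volume_dom_pos : ∀ i, 0 < volume (dom i)
  volume_dom_lt_top : ∀ i, volume (dom i) < ⊤
  /-- observation domain -/
  obs : Set (EuclideanSpace ℝ (Fin n))
  measurableSet_obs : MeasurableSet obs
  obs_subset : obs ⊆ Ω
  /-- initial value in `L²(Ω)` -/
  y₀ : L2 Ω
  /-- target in `L²(0,T;L²(ω_obs))`; the measure is Lebesgue measure on `ω_obs ⊆ Ω` -/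
  yd : Lp (Lp ℝ 2 ((volume.restrict Ω).restrict obs)) 2 (timeMeasure T)
  /-- control cost -/
  α : ℝ
  α_pos : 0 < α

namespace Problem

variable {n N : ℕ} (P : Problem n N)

/-- `L²(0,T;V)`. -/
abbrev StateSpace : Type := Lp P.V 2 (timeMeasure P.T)

/-- The bilinear form of `-A`:
`∫_Ω (a∇w)·∇v + (b·∇w) v + c w v dx`. -/
def form (w v : P.V) : ℝ :=
  ∫ x in P.Ω, (inner ℝ (P.a x (w.1.snd x)) (v.1.snd x) + inner ℝ (P.b x) (w.1.snd x) * v.1.fst x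
    + P.c x * w.1.fst x * v.1.fst x)

/-- The control operator `(Bu)(t,x) = ∑ᵢ χ_{ωᵢ}(x) uᵢ(t)`. -/
def B (u : Control P.T N) (t : ℝ) (x : EuclideanSpace ℝ (Fin n)) : ℝ :=
  ∑ i, (P.dom i).indicator 1 x * u t i

/-- `y ∈ L²(0,T;V)` is the (weak) state for the control `u`: `d/dt (y,v) + form(y,v) = (Bu,v)` on
`(0,T)` for all `v ∈ V`, and `y(0) = y₀`. The test functions in time are smooth and vanish near
`T`, but not necessarily at `0`, so that the identity includes the initial condition. Any
such `y` has `∂ₜy = Ay + Bu ∈ L²(0,T;V')`. -/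
def IsState (u : Control P.T N) (y : P.StateSpace) : Prop :=
  ∀ v : P.V, ∀ η : ℝ → ℝ, ContDiff ℝ ∞ η → HasCompactSupport η → tsupport η ⊆ Iio P.T →
    -(∫ t in Ioo 0 P.T, deriv η t * inner ℝ (y t).1.fst v.1.fst)
        + ∫ t in Ioo 0 P.T, η t * P.form (y t) v
      = (∫ t in Ioo 0 P.T, η t * ∫ x in P.Ω, P.B u t x * v.1.fst x)
        + η 0 * inner ℝ P.y₀ v.1.fst

/-- `S` is the solution operator `u ↦ y`: it assigns to every control the unique state. -/
def IsSolutionOperator (S : Control P.T N → P.StateSpace) : Prop :=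
  ∀ u, P.IsState u (S u) ∧ ∀ y, P.IsState u y → y = S u

/-- Restriction of an element of `V` to the observation domain. -/
def restrictObs : P.V →L[ℝ] Lp ℝ 2 ((volume.restrict P.Ω).restrict P.obs) :=
  (LpToLpRestrictCLM (EuclideanSpace ℝ (Fin n)) ℝ ℝ (volume.restrict P.Ω) 2 P.obs).comp
    ((WithLp.fstL 2 ℝ (L2 P.Ω) (L2vec P.Ω)).comp P.V.subtypeL)

/-- The tracking term `F(u) = ½ ‖Su - y^d‖²` in `L²(0,T;L²(ω_obs))`. -/
def F (S : Control P.T N → P.StateSpace) (u : Control P.T N) : ℝ :=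
  1 / 2 * ‖P.restrictObs.compLp (S u) - P.yd‖ ^ 2

/-- The switching penalty `G(u) = α/2 ∫₀ᵀ |u(t)|₁² dt`. -/
def G (u : Control P.T N) : ℝ :=
  P.α / 2 * ∫ t in Ioo 0 P.T, (∑ j, |u t j|) ^ 2

/-- `u` is a minimizer of `F + G` over `L²(0,T;ℝ^N)`. -/
def IsMinimizer (S : Control P.T N → P.StateSpace) (u : Control P.T N) : Prop :=
  ∀ v : Control P.T N, P.F S u + P.G u ≤ P.F S v + P.G v

end Problem

/-- The index set `{j : |q_j| = maxᵢ |qᵢ|}`. -/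
def activeSet {N : ℕ} (q : EuclideanSpace ℝ (Fin N)) : Finset (Fin N) :=
  Finset.univ.filter fun j => |q j| = ⨆ i, |q i|

/-- The singular arc `{t ∈ (0,T) : |𝒜(t)| > 1}`. -/
def singularArc {T : ℝ} {N : ℕ} (p : Control T N) : Set ℝ :=
  {t ∈ Ioo 0 T | 1 < (activeSet (p t)).card}

end SwitchingControl

end

namespace SwitchingControl

open Filter Topology

/-! The weak formulation is a family of scalar equations, each continuous and affine in `(u, y)`.
Such equations survive limits, so unique solvability makes the solution operator affine with closed
graph, hence continuous (`exists_clm_of_unique_solution`). The tracking term is then half the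
squared norm of a continuous affine map, so it is differentiable.

Minimality of `u` and convexity of `G` make `p = -∇F(u)` a subgradient of `G` at `u`. Since `G` is
an integral functional, this localizes in time (`ae_subgradient_of_integral_subgradient`). What
remains is finite-dimensional: if `q` is a subgradient of `(α/2)|·|₁²` at `x`, then with `M = max
|q_i|`, equality in Fenchel-Young gives `α|x|₁ = M` and `q_j x_j = M|x_j|` for every `j`
(`subgradient_sqL1`). Hence `x` vanishes off the active set, and the weights are the normalized
values `|x_j|`. -/

/-- Integration of `ℓ (f t)` against a square integrable weight is a bounded functional on `L²`. -/
theorem exists_clm_integral_mul {X E : Type*} [MeasurableSpace X] {μ : Measure X}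
    [NormedAddCommGroup E] [NormedSpace ℝ E] {η : X → ℝ} (hη : MemLp η 2 μ) (l : E →L[ℝ] ℝ) :
    ∃ Φ : Lp E 2 μ →L[ℝ] ℝ, ∀ f : Lp E 2 μ, Φ f = ∫ t, η t * l (f t) ∂μ := by
  refine ⟨(innerSL ℝ (hη.toLp η)).comp (l.compLpL 2 μ), fun f => ?_⟩
  rw [ContinuousLinearMap.comp_apply, innerSL_apply_apply, L2.inner_def]
  refine integral_congr_ae ?_
  filter_upwards [hη.coeFn_toLp, l.coeFn_compLpL f] with t h1 h2
  rw [h1, h2]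
  simp [mul_comm]

theorem memLp_restrict_of_continuous_of_hasCompactSupport {η : ℝ → ℝ} (hη : Continuous η)
    (hc : HasCompactSupport η) (T : ℝ) : MemLp η 2 (timeMeasure T) :=
  (hη.memLp_of_hasCompactSupport hc).restrict _

/-- If the affine system `Φ i y = Ψ i u + k i` has exactly one solution `y` for each `u`, then
the solution is a continuous affine function of `u`. -/
theorem exists_clm_of_unique_solution {E F I : Type*} [NormedAddCommGroup E] [NormedSpace ℝ E]
    [CompleteSpace E] [NormedAddCommGroup F] [NormedSpace ℝ F] [CompleteSpace F]
    (Φ : I → F →L[ℝ] ℝ) (Ψ : I → E →L[ℝ] ℝ) (k : I → ℝ) {S : E → F}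
    (hS : ∀ u i, Φ i (S u) = Ψ i u + k i) (hu : ∀ u y, (∀ i, Φ i y = Ψ i u + k i) → y = S u) :
    ∃ L : E →L[ℝ] F, ∀ u, S u = L u + S 0 := by
  have huniq : ∀ u z, (∀ i, Φ i z = Ψ i u) → z = S u - S 0 := fun u z hz => by
    rw [eq_sub_iff_add_eq]
    refine hu u _ fun i => ?_
    rw [map_add, hz, hS, map_zero, zero_add]
  have hdiff : ∀ i u, Φ i (S u - S 0) = Ψ i u := fun i u => by
    rw [map_sub, hS, hS, map_zero]; ring
  let L₀ : E →ₗ[ℝ] F :=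
    { toFun := fun u => S u - S 0
      map_add' := fun u v => (huniq _ _ fun i => by rw [map_add, hdiff, hdiff, map_add]).symm
      map_smul' := fun c u => (huniq _ _ fun i => by
        rw [RingHom.id_apply, map_smul, hdiff, map_smul]).symm }
  -- A limit of graph points still satisfies every homogeneous equation, so uniqueness puts it on
  -- the graph.
  refine ⟨ContinuousLinearMap.ofSeqClosedGraph (g := L₀) fun s x y hs hy => ?_, fun u => ?_⟩
  · refine huniq _ _ fun i => ?_
    refine tendsto_nhds_unique (((Φ i).continuous.tendsto y).comp hy) ?_
    refine (((Ψ i).continuous.tendsto x).comp hs).congr fun j => ?_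
    exact (hdiff i (s j)).symm
  · exact (sub_add_cancel (S u) (S 0)).symm

theorem differentiable_half_norm_sq_affine {E F H : Type*} [NormedAddCommGroup E]
    [NormedSpace ℝ E] [NormedAddCommGroup F] [NormedSpace ℝ F] [NormedAddCommGroup H]
    [InnerProductSpace ℝ H] (L : E →L[ℝ] F) (C : F →L[ℝ] H) {y : F} (d : H) {S : E → F}
    (hS : ∀ u, S u = L u + y) {R : F → H} (hR : ∀ z, C z = R z) :
    Differentiable ℝ fun u => 1 / 2 * ‖R (S u) - d‖ ^ 2 := by
  simp only [hS, ← hR]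
  refine Differentiable.const_mul (Differentiable.norm_sq ℝ ?_) _
  fun_prop

/-! ### Continuity of the control-to-state map -/

namespace Problem

variable {n N : ℕ} (P : Problem n N)

/-- For fixed `v`, the bilinear form is a bounded functional of its first argument. -/
theorem exists_clm_form (v : P.V) : ∃ l : P.V →L[ℝ] ℝ, ∀ w : P.V, l w = P.form w v := by
  have hv1 : MemLp v.1.fst 2 (volume.restrict P.Ω) := Lp.memLp _
  have hv2 : MemLp v.1.snd 2 (volume.restrict P.Ω) := Lp.memLp _
  -- Transposing `a` and moving all coefficients onto `v` turns the form into an `L²` pairing of `w`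
  -- and its gradient with fixed functions.
  have hg : MemLp (fun x => (P.a x).adjoint (v.1.snd x) + v.1.fst x • P.b x) 2
      (volume.restrict P.Ω) := by
    refine MemLp.add ?_ (P.b_memLp.smul hv1)
    refine MemLp.of_bilin (p := ⊤) (q := 2) (r := 2) (fun a w => a.adjoint w) 1 P.a_memLp hv2 ?_ ?_
    · have h1 : AEStronglyMeasurable (fun x => (P.a x).adjoint) (volume.restrict P.Ω) :=
        (LinearIsometryEquiv.continuous ContinuousLinearMap.adjoint).comp_aestronglyMeasurable
          P.a_memLp.1
      exact (isBoundedBilinearMap_apply (𝕜 := ℝ) (E := EuclideanSpace ℝ (Fin n))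
        (F := EuclideanSpace ℝ (Fin n))).continuous.comp_aestronglyMeasurable (h1.prodMk hv2.1)
    · refine Eventually.of_forall fun x => ?_
      have := ((P.a x).adjoint).le_opNorm (v.1.snd x)
      rw [LinearIsometryEquiv.norm_map] at this
      rw [one_mul]
      exact this
  have hc : MemLp (fun x => P.c x * v.1.fst x) 2 (volume.restrict P.Ω) := hv1.mul P.c_memLp
  let l1 : P.V →L[ℝ] ℝ := (innerSL ℝ (hg.toLp _)).comp
    ((WithLp.sndL 2 ℝ (L2 P.Ω) (L2vec P.Ω)).comp P.V.subtypeL)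
  let l2 : P.V →L[ℝ] ℝ := (innerSL ℝ (hc.toLp _)).comp
    ((WithLp.fstL 2 ℝ (L2 P.Ω) (L2vec P.Ω)).comp P.V.subtypeL)
  refine ⟨l1 + l2, fun w => ?_⟩
  change inner ℝ (hg.toLp _) w.1.snd + inner ℝ (hc.toLp _) w.1.fst = _
  rw [L2.inner_def, L2.inner_def,
    ← integral_add (L2.integrable_inner _ _) (L2.integrable_inner _ _), form]
  refine integral_congr_ae ?_
  filter_upwards [hg.coeFn_toLp, hc.coeFn_toLp] with x h1 h2
  rw [h1, h2, inner_add_left, ContinuousLinearMap.adjoint_inner_left, real_inner_smul_left,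
    real_inner_comm]
  simp only [RCLike.inner_apply, conj_trivial]
  ring

/-- For fixed `v`, the pairing `(Bu(t), v)` is a bounded functional of `u(t)`. -/
theorem exists_clm_B (v : L2 P.Ω) : ∃ l : EuclideanSpace ℝ (Fin N) →L[ℝ] ℝ,
    ∀ (u : Control P.T N) (t : ℝ), l (u t) = ∫ x in P.Ω, P.B u t x * v x := by
  have hint : ∀ i, Integrable (fun x => (P.dom i).indicator (1 : EuclideanSpace ℝ (Fin n) → ℝ) x * v x)
      (volume.restrict P.Ω) := fun i => by
    refine MemLp.integrable_mul (p := 2) (q := 2) ?_ (Lp.memLp v)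
    exact memLp_indicator_const 2 (P.measurableSet_dom i) (1 : ℝ)
      (Or.inr ((Measure.restrict_apply_le _ _).trans_lt (P.volume_dom_lt_top i)).ne)
  refine ⟨∑ i, (∫ x in P.Ω, (P.dom i).indicator (1 : EuclideanSpace ℝ (Fin n) → ℝ) x * v x) •
    EuclideanSpace.proj i, fun u t => ?_⟩
  simp only [B, Finset.sum_mul, sum_apply]
  rw [integral_finsetSum]
  · refine Finset.sum_congr rfl fun i _ => ?_
    simp only [smul_apply, PiLp.proj_apply, smul_eq_mul]
    rw [← integral_mul_const]
    exact integral_congr_ae (Eventually.of_forall fun x => by ring)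
  · intro i _
    refine ((hint i).mul_const (u t i)).congr (Eventually.of_forall fun x => by ring)

/-- The weak formulation is a family of scalar equations, affine and continuous in `(u, y)`. -/
theorem isState_iff_forall_clm : ∃ (I : Type) (Φ : I → P.StateSpace →L[ℝ] ℝ)
    (Ψ : I → Control P.T N →L[ℝ] ℝ) (k : I → ℝ),
    ∀ u y, P.IsState u y ↔ ∀ i, Φ i y = Ψ i u + k i := by
  have key : ∀ (v : P.V) (η : {η : ℝ → ℝ // ContDiff ℝ ∞ η ∧ HasCompactSupport η ∧
      tsupport η ⊆ Iio P.T}), ∃ (Φ : P.StateSpace →L[ℝ] ℝ) (Ψ : Control P.T N →L[ℝ] ℝ),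
      (∀ y, Φ y = -(∫ t in Ioo 0 P.T, deriv η.1 t * inner ℝ (y t).1.fst v.1.fst)
        + ∫ t in Ioo 0 P.T, η.1 t * P.form (y t) v) ∧
      ∀ u, Ψ u = ∫ t in Ioo 0 P.T, η.1 t * ∫ x in P.Ω, P.B u t x * v.1.fst x := by
    rintro v ⟨η, h1, h2, -⟩
    obtain ⟨l, hl⟩ := P.exists_clm_form v
    obtain ⟨m, hm⟩ := P.exists_clm_B v.1.fst
    let q : P.V →L[ℝ] ℝ := (innerSL ℝ v.1.fst).comp
      ((WithLp.fstL 2 ℝ (L2 P.Ω) (L2vec P.Ω)).comp P.V.subtypeL)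
    obtain ⟨Φ₁, h₁⟩ := exists_clm_integral_mul
      (memLp_restrict_of_continuous_of_hasCompactSupport
        (h1.continuous_deriv (by simp)) h2.deriv P.T) q
    obtain ⟨Φ₂, h₂⟩ := exists_clm_integral_mul
      (memLp_restrict_of_continuous_of_hasCompactSupport h1.continuous h2 P.T) l
    obtain ⟨Ψ, h₃⟩ := exists_clm_integral_mul
      (memLp_restrict_of_continuous_of_hasCompactSupport h1.continuous h2 P.T) m
    refine ⟨-Φ₁ + Φ₂, Ψ, fun y => ?_, fun u => ?_⟩
    · have hq : ∀ w : P.V, q w = inner ℝ w.1.fst v.1.fst := fun w =>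
        real_inner_comm w.1.fst v.1.fst
      rw [add_apply, neg_apply, h₁, h₂]
      simp only [hl, hq]
    · rw [h₃]
      simp only [hm]
  choose Φ Ψ hΦ hΨ using key
  refine ⟨_ × _, fun i => Φ i.1 i.2, fun i => Ψ i.1 i.2,
    fun i => i.2.1 0 * inner ℝ P.y₀ i.1.1.fst, fun u y => ?_⟩
  simp only [hΦ, hΨ]
  exact ⟨fun h i => h i.1 i.2.1 i.2.2.1 i.2.2.2.1 i.2.2.2.2,
    fun h v η a b c => h (v, ⟨η, a, b, c⟩)⟩

variable {P}

/-- The solution operator is affine and, by the closed graph theorem, continuous. -/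
theorem IsSolutionOperator.exists_clm {S : Control P.T N → P.StateSpace}
    (hS : P.IsSolutionOperator S) :
    ∃ L : Control P.T N →L[ℝ] P.StateSpace, ∀ u, S u = L u + S 0 := by
  obtain ⟨I, Φ, Ψ, k, h⟩ := P.isState_iff_forall_clm
  have : CompleteSpace P.V := P.isClosed_V.completeSpace_coe
  exact exists_clm_of_unique_solution Φ Ψ k (fun u => (h u _).1 (hS u).1)
    fun u y hy => (hS u).2 y ((h u y).2 hy)

/-- The tracking term is Fréchet differentiable. -/
theorem IsSolutionOperator.differentiable_F {S : Control P.T N → P.StateSpace}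
    (hS : P.IsSolutionOperator S) : Differentiable ℝ (P.F S) := by
  obtain ⟨L, hL⟩ := hS.exists_clm
  exact differentiable_half_norm_sq_affine L (P.restrictObs.compLpL 2 (timeMeasure P.T)) P.yd hL
    (fun _ => rfl)

end Problem

/-! ### Subgradients of the squared `ℓ¹`-norm -/

section Subgradient

variable {N : ℕ}

/-- The squared `ℓ¹`-norm on `ℝ^N`. -/
def sqL1 (x : EuclideanSpace ℝ (Fin N)) : ℝ := (∑ j, |x j|) ^ 2

theorem continuous_sqL1 : Continuous (sqL1 (N := N)) := by
  unfold sqL1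
  fun_prop

theorem sqL1_convex_combination {ε : ℝ} (h0 : 0 ≤ ε) (h1 : ε ≤ 1)
    (x y : EuclideanSpace ℝ (Fin N)) :
    sqL1 (x + ε • (y - x)) ≤ (1 - ε) * sqL1 x + ε * sqL1 y := by
  unfold sqL1
  set A := ∑ j, |x j|
  set B := ∑ j, |y j|
  have hC : ∑ j, |(x + ε • (y - x)) j| ≤ (1 - ε) * A + ε * B := by
    rw [Finset.mul_sum, Finset.mul_sum, ← Finset.sum_add_distrib]
    refine Finset.sum_le_sum fun j _ => ?_
    have : (x + ε • (y - x)) j = (1 - ε) * x j + ε * y j := by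
      simp only [PiLp.add_apply, PiLp.smul_apply, PiLp.sub_apply, smul_eq_mul]; ring
    rw [this]
    refine (abs_add_le _ _).trans (le_of_eq ?_)
    rw [abs_mul, abs_mul, abs_of_nonneg h0, abs_of_nonneg (sub_nonneg.2 h1)]
  have hC0 : 0 ≤ ∑ j, |(x + ε • (y - x)) j| := Finset.sum_nonneg fun j _ => abs_nonneg _
  have h2 := pow_le_pow_left₀ hC0 hC 2
  -- The convexity gap of the square is exactly `ε (1 - ε) (A - B)²`.
  nlinarith [mul_nonneg (mul_nonneg h0 (sub_nonneg.2 h1)) (sq_nonneg (A - B))]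

theorem integrable_sqL1 {X : Type*} [MeasurableSpace X] {μ : Measure X}
    {f : X → EuclideanSpace ℝ (Fin N)} (hf : MemLp f 2 μ) :
    Integrable (fun t => sqL1 (f t)) μ := by
  refine MemLp.integrable_sq (f := fun t => ∑ j, |f t j|) ?_
  exact memLp_finsetSum _ fun j _ =>
    (((EuclideanSpace.proj (𝕜 := ℝ) j).comp_memLp' hf).abs :)

/-- A subgradient of `v ↦ c ∫ |v(t)|₁² dt` at `u` in `L²` is pointwise almost everywhere a
subgradient of `c |·|₁²` at `u(t)`. -/
theorem ae_subgradient_of_integral_subgradient {X : Type*} [MeasurableSpace X] {μ : Measure X}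
    [IsFiniteMeasure μ] {c : ℝ} {u p : Lp (EuclideanSpace ℝ (Fin N)) 2 μ}
    (h : ∀ v : Lp (EuclideanSpace ℝ (Fin N)) 2 μ,
      inner ℝ p (v - u) ≤ c * ∫ t, sqL1 (v t) ∂μ - c * ∫ t, sqL1 (u t) ∂μ) :
    ∀ᵐ t ∂μ, ∀ w : EuclideanSpace ℝ (Fin N),
      inner ℝ (p t) (w - u t) ≤ c * sqL1 w - c * sqL1 (u t) := by
  have hu := Lp.memLp u
  have key : ∀ w : EuclideanSpace ℝ (Fin N), ∀ᵐ t ∂μ,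
      0 ≤ c * sqL1 w - c * sqL1 (u t) - inner ℝ (p t) (w - u t) := by
    intro w
    have hw : MemLp (fun t => w - u t) 2 μ := (memLp_const w).sub hu
    have hint : Integrable (fun t => c * sqL1 w - c * sqL1 (u t)) μ :=
      (integrable_const _).sub ((integrable_sqL1 hu).const_mul c)
    have hint2 : Integrable (fun t => inner ℝ (p t) (w - u t)) μ :=
      (L2.integrable_inner p (hw.toLp _)).congr (hw.coeFn_toLp.mono fun t ht => by
        simp only [ht])
    refine ae_nonneg_of_forall_setIntegral_nonneg (hint.sub hint2) fun s hs _ => ?_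
    -- The competitor equals `w` on `s` and `u` elsewhere, so the global inequality reduces to an
    -- integral over `s`.
    have hd : MemLp (s.indicator fun t => w - u t) 2 μ := hw.indicator hs
    have hv := h (u + hd.toLp _)
    rw [add_sub_cancel_left, L2.inner_def, ← mul_sub,
      ← integral_sub (integrable_sqL1 (Lp.memLp _)) (integrable_sqL1 hu), ← integral_const_mul,
      ← sub_nonneg, ← integral_sub] at hv
    · rw [← integral_indicator hs]
      refine hv.trans_eq (integral_congr_ae ?_)
      filter_upwards [hd.coeFn_toLp, Lp.coeFn_add u (hd.toLp _)] with t h1 h2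
      rw [h2, Pi.add_apply, h1]
      by_cases hts : t ∈ s
      · simp only [indicator_of_mem hts, add_sub_cancel]
        ring
      · simp [indicator_of_notMem hts]
    · exact ((integrable_sqL1 (Lp.memLp _)).sub (integrable_sqL1 hu)).const_mul c
    · exact L2.integrable_inner _ _
  -- The null set depends on `w`; a countable dense set of `w` gives a common one, and continuity in
  -- `w` extends the inequality to all of `ℝ^N`.
  have hall := ae_all_iff.2 fun i =>
    key (TopologicalSpace.denseSeq (EuclideanSpace ℝ (Fin N)) i)
  filter_upwards [hall] with t ht w
  rw [← sub_nonneg]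
  have hcl : IsClosed {w : EuclideanSpace ℝ (Fin N) |
      0 ≤ c * sqL1 w - c * sqL1 (u t) - inner ℝ (p t) (w - u t)} := by
    refine isClosed_le continuous_const ?_
    have := continuous_sqL1 (N := N)
    fun_prop
  have hsub := hcl.closure_subset_iff.2 (range_subset_iff.2 ht)
  rw [(TopologicalSpace.denseRange_denseSeq _).closure_range] at hsub
  exact hsub (mem_univ w)

/-- Subgradients of `(α/2) |·|₁²`: the Fenchel equalities. -/
theorem subgradient_sqL1 (hN : 0 < N) {α : ℝ} (hα : 0 < α) {q x : EuclideanSpace ℝ (Fin N)}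
    (h : ∀ w, inner ℝ q (w - x) ≤ α / 2 * sqL1 w - α / 2 * sqL1 x) :
    α * ∑ j, |x j| = ⨆ i, |q i| ∧ ∀ j, q j * x j = (⨆ i, |q i|) * |x j| := by
  have : Nonempty (Fin N) := ⟨⟨0, hN⟩⟩
  obtain ⟨j, hj⟩ := exists_eq_ciSup_of_finite (f := fun i => |q i|)
  have hle : ∀ i, |q i| ≤ ⨆ i, |q i| := fun i =>
    le_ciSup (f := fun i => |q i|) (finite_range _).bddAbove i
  set M := ⨆ i, |q i| with hM
  have hqx : inner ℝ q x = ∑ i, q i * x i := by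
    simp [PiLp.inner_apply, mul_comm]
  -- This point maximizes `⟨q, w⟩ - (α/2)|w|₁²`, with value `M²/(2α)`, the conjugate function at
  -- `q`.
  have hw := h (EuclideanSpace.single j (q j / α))
  have hs : sqL1 (EuclideanSpace.single j (q j / α)) = (M / α) ^ 2 := by
    unfold sqL1
    rw [Finset.sum_eq_single j]
    · rw [← hj]; simp [abs_div, abs_of_pos hα]
    · intro i _ hi; simp [hi]
    · simp
  have hi : inner ℝ q (EuclideanSpace.single j (q j / α)) = M ^ 2 / α := by
    rw [EuclideanSpace.inner_single_right, ← hj, sq_abs]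
    simp; ring
  rw [inner_sub_right, hs, hi, hqx, sqL1] at hw
  have hterm : ∀ i, q i * x i ≤ M * |x i| := fun i =>
    (le_abs_self _).trans (by
      rw [abs_mul]; exact mul_le_mul_of_nonneg_right (hle i) (abs_nonneg _))
  have hsum : ∑ i, q i * x i ≤ M * ∑ i, |x i| := by
    rw [Finset.mul_sum]; exact Finset.sum_le_sum fun i _ => hterm i
  set A := ∑ i, |x i|
  set Q := ∑ i, q i * x i
  have hQ : M ^ 2 + (α * A) ^ 2 ≤ 2 * α * Q := by
    have e1 : α * (M ^ 2 / α) = M ^ 2 := by field_simp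
    have e2 : α * (α / 2 * (M / α) ^ 2) = M ^ 2 / 2 := by field_simp
    have := mul_le_mul_of_nonneg_left hw hα.le
    rw [mul_sub, mul_sub, e1, e2] at this
    nlinarith
  have hsum' := mul_le_mul_of_nonneg_left hsum hα.le
  have hAM : α * A = M := by
    -- Combine `hQ` with Hölder's bound `Q ≤ M A`.
    have : (α * A - M) ^ 2 ≤ 0 := by nlinarith
    have := pow_eq_zero_iff (two_ne_zero) |>.1 (le_antisymm this (sq_nonneg _))
    linarith
  refine ⟨hAM, ?_⟩
  have hQA : Q = ∑ i, M * |x i| := by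
    rw [← Finset.mul_sum]
    refine le_antisymm hsum (le_of_mul_le_mul_left ?_ hα)
    rw [hAM] at hQ
    have : α * (M * A) = M * M := by rw [← hAM]; ring
    nlinarith
  intro i
  -- Equality in Hölder's inequality forces equality in each summand.
  exact (Finset.sum_eq_sum_iff_of_le fun i _ => hterm i).1 hQA i (Finset.mem_univ i)

/-- An inactive index of a subgradient carries a vanishing component. -/
theorem eq_zero_of_abs_lt_iSup {q x : EuclideanSpace ℝ (Fin N)}
    (h : ∀ j, q j * x j = (⨆ i, |q i|) * |x j|) {j : Fin N} (hj : |q j| < ⨆ i, |q i|) :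
    x j = 0 := by
  by_contra hx
  have h1 : q j * x j ≤ |q j| * |x j| := (le_abs_self _).trans_eq (abs_mul _ _)
  have h2 := mul_lt_mul_of_pos_right hj (abs_pos.2 hx)
  linarith [h j]

/-- Subgradients of `(α/2) |·|₁²` in terms of convex weights on the active set. -/
theorem exists_weights_of_subgradient (hN : 0 < N) {α : ℝ} (hα : 0 < α)
    {q x : EuclideanSpace ℝ (Fin N)} (hsum : α * ∑ j, |x j| = ⨆ i, |q i|)
    (h : ∀ j, q j * x j = (⨆ i, |q i|) * |x j|) :
    ∃ s : Fin N → ℝ, (∀ j, 0 ≤ s j) ∧ ∑ i ∈ activeSet q, s i = 1 ∧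
      ∀ j, |q j| = (⨆ i, |q i|) → x j = s j / α * q j := by
  have : Nonempty (Fin N) := ⟨⟨0, hN⟩⟩
  obtain ⟨j₀, hj₀⟩ := exists_eq_ciSup_of_finite (f := fun i => |q i|)
  have hlt : ∀ j, j ∉ activeSet q → x j = 0 := fun j hj => by
    refine eq_zero_of_abs_lt_iSup h (lt_of_le_of_ne
      (le_ciSup (f := fun i => |q i|) (finite_range _).bddAbove j) ?_)
    simpa [activeSet] using hj
  have hmem : j₀ ∈ activeSet q := by simpa [activeSet] using hj₀
  set M := ⨆ i, |q i|
  have hM : 0 ≤ M := hj₀ ▸ abs_nonneg _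
  rcases hM.eq_or_lt with hM0 | hM0
  -- For `M = 0` both `x` and the active components of `q` vanish, so any convex weights on the
  -- active set serve.
  · refine ⟨fun j => if j = j₀ then 1 else 0, fun j => ?_, ?_, fun j hj => ?_⟩
    · dsimp only; split_ifs <;> norm_num
    · rw [Finset.sum_ite_eq', if_pos hmem]
    · have hA : ∑ j, |x j| = 0 := by
        rw [← hM0] at hsum
        exact (mul_eq_zero.1 hsum).resolve_left hα.ne'
      have hx := (Finset.sum_eq_zero_iff_of_nonneg fun i _ => abs_nonneg (x i)).1 hA j
        (Finset.mem_univ j)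
      rw [abs_eq_zero.1 hx, abs_eq_zero.1 (hj.trans hM0.symm), mul_zero]
  -- These sum to one over the active set because `x` vanishes off it and `α|x|₁ = M`.
  · refine ⟨fun j => α * |x j| / M, fun j => by positivity, ?_, fun j hj => ?_⟩
    · rw [← Finset.sum_div, ← Finset.mul_sum, div_eq_one_iff_eq hM0.ne', ← hsum]
      congr 1
      exact Finset.sum_subset (Finset.subset_univ _) fun i _ hi => by rw [hlt i hi, abs_zero]
    · have h2 : q j * q j = M * M := by rw [← hj, abs_mul_abs_self]
      -- Multiply `q_j x_j = M|x_j|` by `q_j` and use `q_j² = M²`.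
      have h3 : M * (M * x j) = M * (|x j| * q j) := by
        linear_combination (-x j) * h2 + q j * h j
      have h4 := mul_left_cancel₀ hM0.ne' h3
      field_simp
      linarith

/-! ### First-order optimality -/

namespace Problem

variable {n : ℕ} {P : Problem n N}

theorem G_convex_combination {ε : ℝ} (h0 : 0 ≤ ε) (h1 : ε ≤ 1) (u v : Control P.T N) :
    P.G (u + ε • (v - u)) ≤ (1 - ε) * P.G u + ε * P.G v := by
  have hu := integrable_sqL1 (Lp.memLp u)
  have hv := integrable_sqL1 (Lp.memLp v)
  have : ∫ t in Ioo 0 P.T, sqL1 ((u + ε • (v - u) : Control P.T N) t) ≤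
      (1 - ε) * (∫ t in Ioo 0 P.T, sqL1 (u t)) + ε * ∫ t in Ioo 0 P.T, sqL1 (v t) := by
    rw [← integral_const_mul, ← integral_const_mul,
      ← integral_add (hu.const_mul _) (hv.const_mul _)]
    refine integral_mono_ae (integrable_sqL1 (Lp.memLp _))
      ((hu.const_mul _).add (hv.const_mul _)) ?_
    filter_upwards [Lp.coeFn_add u (ε • (v - u)), Lp.coeFn_smul ε (v - u),
      Lp.coeFn_sub v u] with t e1 e2 e3
    rw [e1, Pi.add_apply, e2, Pi.smul_apply, e3, Pi.sub_apply]
    exact sqL1_convex_combination h0 h1 _ _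
  have h := mul_le_mul_of_nonneg_left this (half_pos P.α_pos).le
  refine h.trans_eq ?_
  simp only [G, sqL1]
  ring

/-- First order optimality: the negative gradient of `F` is a subgradient of `G`. -/
theorem IsMinimizer.inner_neg_gradient_le {S : Control P.T N → P.StateSpace} {u : Control P.T N}
    (hu : P.IsMinimizer S u) (hF : DifferentiableAt ℝ (P.F S) u) (v : Control P.T N) :
    inner ℝ (-gradient (P.F S) u) (v - u) ≤ P.G v - P.G u := by
  have hd := (hF.hasGradientAt.hasFDerivAt.hasLineDerivAt (v - u)).tendsto_slope_zero_right
  rw [InnerProductSpace.toDual_apply_apply] at hd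
  have : P.G u - P.G v ≤ inner ℝ (gradient (P.F S) u) (v - u) := by
    -- By minimality, `F` drops along the segment by at most the increase of `G`, which convexity
    -- bounds by `ε (G v - G u)`; divide by `ε`.
    refine ge_of_tendsto hd ?_
    filter_upwards [Ioo_mem_nhdsGT (zero_lt_one' ℝ)] with ε hε
    have h1 := hu (u + ε • (v - u))
    have h2 := G_convex_combination hε.1.le hε.2.le u v
    rw [smul_eq_mul, inv_mul_eq_div, le_div_iff₀ hε.1]
    linarith
  rw [inner_neg_left]
  linarith

end Problem

end Subgradient

end SwitchingControl

theorem mainTheorem1 {n N : ℕ} (hN : 0 < N) (P : SwitchingControl.Problem n N)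
    (S : SwitchingControl.Control P.T N → P.StateSpace) (hS : P.IsSolutionOperator S)
    (u : SwitchingControl.Control P.T N) (hu : P.IsMinimizer S u) :
    DifferentiableAt ℝ (P.F S) u ∧
    ∀ p : SwitchingControl.Control P.T N, p = -gradient (P.F S) u →
      (∀ᵐ t ∂(SwitchingControl.timeMeasure P.T),
        ∃ s : Fin N → ℝ, (∀ j, 0 ≤ s j) ∧ ∑ i ∈ SwitchingControl.activeSet (p t), s i = 1 ∧
          ∀ j : Fin N,
            (|p t j| = (⨆ i, |p t i|) → (∀ i, i ≠ j → |p t i| < |p t j|) →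
              u t j = 1 / P.α * p t j) ∧
            (|p t j| < (⨆ i, |p t i|) → u t j = 0) ∧
            (|p t j| = (⨆ i, |p t i|) → (∃ i, i ≠ j ∧ |p t j| = |p t i|) →
              u t j = s j / P.α * p t j)) ∧
      (∀ᵐ t ∂(SwitchingControl.timeMeasure P.T), t ∉ SwitchingControl.singularArc p →
        ∀ j₁ j₂ : Fin N, j₁ ≠ j₂ → u t j₁ * u t j₂ = 0) := by
  have hF := hS.differentiable_F u
  refine ⟨hF, fun p hp => ?_⟩
  have hsub := SwitchingControl.ae_subgradient_of_integral_subgradient (c := P.α / 2)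
    (u := u) (p := p) fun v => hp ▸ hu.inner_neg_gradient_le hF v
  refine ⟨?_, ?_⟩
  · filter_upwards [hsub] with t ht
    obtain ⟨h1, h2⟩ := SwitchingControl.subgradient_sqL1 hN P.α_pos ht
    obtain ⟨s, hs0, hs1, hs⟩ := SwitchingControl.exists_weights_of_subgradient hN P.α_pos h1 h2
    refine ⟨s, hs0, hs1, fun j => ⟨fun hj hlt => ?_,
      SwitchingControl.eq_zero_of_abs_lt_iSup h2, fun hj _ => hs j hj⟩⟩
    -- With a strict maximizer the weights sum over one index, so `s_j = 1`.
    have hact : SwitchingControl.activeSet (p t) = {j} := by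
      ext i
      simp only [SwitchingControl.activeSet, Finset.mem_filter, Finset.mem_univ, true_and,
        Finset.mem_singleton]
      refine ⟨fun hi => ?_, fun hi => hi ▸ hj⟩
      by_contra hne
      exact (hlt i hne).ne (hi.trans hj.symm)
    rw [hact, Finset.sum_singleton] at hs1
    rw [hs j hj, hs1]
  · filter_upwards [hsub, ae_restrict_mem measurableSet_Ioo] with t ht htT hsing j₁ j₂ hne
    obtain ⟨-, h2⟩ := SwitchingControl.subgradient_sqL1 hN P.α_pos ht
    have hcard : (SwitchingControl.activeSet (p t)).card ≤ 1 :=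
      not_lt.1 fun hlt => hsing ⟨htT, hlt⟩
    have hzero : ∀ j, j ∉ SwitchingControl.activeSet (p t) → u t j = 0 := fun j hj => by
      refine SwitchingControl.eq_zero_of_abs_lt_iSup h2 (lt_of_le_of_ne
        (le_ciSup (f := fun i => |p t i|) (finite_range _).bddAbove j) ?_)
      simpa [SwitchingControl.activeSet] using hj
    by_cases hj : j₁ ∈ SwitchingControl.activeSet (p t)
    · rw [hzero j₂ fun hj' => hne (Finset.card_le_one.1 hcard _ hj _ hj'), mul_zero]
    · rw [hzero j₁ hj, zero_mul]
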